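/- Let $\mathcal H$ be the Fock space of one bosonic mode with Fock basis $(|k\rangle)_{k\ge 0}$, and for $\alpha\in\mathbb C$ let $|\alpha\rangle = e^{-|\alpha|^2/2}\sum_{k\ge 0}\frac{\alpha^k}{\sqrt{k!}}\,|k\rangle$ be the coherent state (for numbers $k\in\mathbb N$, $|k\rangle$ always denotes a Fock state). Let $\bar m>0$, let $X_G\sim\mathbb{C}\mathcal N(0,\bar m)$ have density $\frac{1}{\pi\bar m}e^{-|z|^2/\bar m}$ on $\mathbb C$, and let $\rho_{X_G}=\mathbb E\big[|X_G\rangle\langle X_G|\big]$ be the Gaussian mixture of coherent states. Let $(X_n)_n$ be random variables taking values in finite sets $\mathcal X_n\subset\mathbb C$, with coherent-state mixtures $\rho_{X_n}=\sum_{x\in\mathcal X_n}p_{X_n}(x)\,|x\rangle\langle x|$ (with $|x\rangle$ coherent states), and assume that $\rho_{X_n}\to\rho_{X_G}$ weakly, that is, $\langle\psi,\rho_{X_n}\chi\rangle\to\langle\psi,\rho_{X_G}\chi\rangle$ for all $\psi,\chi\in\mathcal H$. For each $n$ let $$\rho_{X_n}=\sum_{k=0}^{N_n-1}\lambda_{k,n}\,|\phi_{k,n}\rangle\langle\phi_{k,n}|$$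 be a spectral decomposition with $\phi_{0,n},\dots,\phi_{N_n-1,n}$ orthonormal and $\lambda_{0,n}\ge\lambda_{1,n}\ge\dots\ge\lambda_{N_n-1,n}$. Then $\rho_{X_G}$ is the thermal state with spectral decomposition $$\rho_{X_G}=\sum_{k=0}^\infty\lambda_k\,|k\rangle\langle k|,\qquad \lambda_k=\frac{\bar m^k}{(\bar m+1)^{k+1}}$$ (convergent in operator norm), and for every $k\in\mathbb N=\{0,1,2,\dots\}$ one has $N_n>k$ for all sufficiently large $n$, and 1. $\lim_{n\to\infty}|\lambda_{k,n}-\lambda_k|=0$; 2. $\lim_{n\to\infty}\big\|\,|\phi_{k,n}\rangle\langle\phi_{k,n}|-|k\rangle\langle k|\,\big\|_1=0$, where $\|\cdot\|_1$ is the trace norm. -/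

import Mathlib

open Filter Topology MeasureTheory

noncomputable section

/-- The Fock space of one bosonic mode, realised as `ℓ²(ℕ, ℂ)`. -/
abbrev FockSpace : Type := lp (fun _ : ℕ => ℂ) 2

/-- The Fock (photon number) state `|k⟩`, i.e. the `k`-th standard basis vector. -/
def fockState (k : ℕ) : FockSpace := lp.single 2 k (1 : ℂ)

/-- The operator `|ψ⟩⟨ψ|`, i.e. `x ↦ ⟨ψ, x⟩ ψ`. -/
def ketBra (ψ : FockSpace) : FockSpace →L[ℂ] FockSpace :=
  InnerProductSpace.rankOne ℂ ψ ψ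

/-- The coordinate `⟨k | α⟩ = exp (-|α|² / 2) αᵏ / √(k!)` of a coherent state. -/
def coherentCoeff (α : ℂ) (k : ℕ) : ℂ :=
  (Real.exp (-(‖α‖ ^ 2) / 2) : ℂ) * (α ^ k / (Real.sqrt (k.factorial : ℝ) : ℂ))

theorem memℓp_coherentCoeff (α : ℂ) : Memℓp (coherentCoeff α) 2 := by
  apply memℓp_gen
  have h : Summable fun k : ℕ =>
      Real.exp (-(‖α‖ ^ 2) / 2) ^ 2 * ((‖α‖ ^ 2) ^ k / (k.factorial : ℝ)) :=
    (Real.summable_pow_div_factorial (‖α‖ ^ 2)).mul_left _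
  refine h.congr fun k => ?_
  have h2 : Real.sqrt (k.factorial : ℝ) ^ 2 = (k.factorial : ℝ) :=
    Real.sq_sqrt (Nat.cast_nonneg _)
  simp only [coherentCoeff, norm_mul, norm_div, norm_pow, Complex.norm_real, Real.norm_eq_abs,
    ENNReal.toReal_ofNat, Real.rpow_two, mul_pow, div_pow, sq_abs, h2]
  ring

/-- The coherent state `|α⟩ = exp (-|α|² / 2) ∑ₖ αᵏ / √(k!) |k⟩`. -/
def coherentState (α : ℂ) : FockSpace := ⟨coherentCoeff α, memℓp_coherentCoeff α⟩

/-- A constellation: a random variable with values in a finite set of complex numbers, given by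
its alphabet and its probability mass function. -/
structure Constellation where
  /-- the alphabet -/
  alphabet : Finset ℂ
  /-- the probability of each symbol -/
  prob : ℂ → ℝ
  prob_nonneg : ∀ x ∈ alphabet, 0 ≤ prob x
  prob_sum : ∑ x ∈ alphabet, prob x = 1

/-- The mixture `ρ_X = ∑ₓ p(x) |x⟩⟨x|` of coherent states induced by a constellation. -/
def Constellation.state (X : Constellation) : FockSpace →L[ℂ] FockSpace :=
  ∑ x ∈ X.alphabet, X.prob x • ketBra (coherentState x)

/-- The circularly symmetric complex Gaussian distribution with mean `0` and variance
`E|X|² = m > 0`, given by its Lebesgue density `exp (-|z|² / m) / (π m)`. -/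
def complexGaussian (m : ℝ) : Measure ℂ :=
  volume.withDensity fun z => ENNReal.ofReal (Real.exp (-(‖z‖ ^ 2) / m) / (Real.pi * m))

/-- The Gaussian mixture of coherent states `∫ |z⟩⟨z| dμ(z)`, where `μ` is the complex Gaussian
distribution of variance `m` (a Bochner integral in the operator norm). -/
def gaussianState (m : ℝ) : FockSpace →L[ℂ] FockSpace :=
  ∫ z, ketBra (coherentState z) ∂(complexGaussian m)

/-- The number `mᵏ / (m + 1)ᵏ⁺¹`. -/
def thermalEigenvalue (m : ℝ) (k : ℕ) : ℝ := m ^ k / (m + 1) ^ (k + 1)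

/-- Convergence of a sequence of bounded operators in the weak operator topology. -/
def WeaklyConverges (ρ : ℕ → FockSpace →L[ℂ] FockSpace) (σ : FockSpace →L[ℂ] FockSpace) : Prop :=
  ∀ ψ χ : FockSpace, Tendsto (fun n => inner ℂ ψ (ρ n χ)) atTop (𝓝 (inner ℂ ψ (σ χ)))

/-- `T = ∑_{k < N} lam k |φ k⟩⟨φ k|` with `φ 0, …, φ (N - 1)` orthonormal and
`lam 0 ≥ … ≥ lam (N - 1)`; the values of `lam` and `φ` at indices `k ≥ N` play no role. -/
structure IsSpectralDecomposition (T : FockSpace →L[ℂ] FockSpace) (N : ℕ) (lam : ℕ → ℝ)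
    (φ : ℕ → FockSpace) : Prop where
  orthonormal : Orthonormal ℂ fun k : Fin N => φ k
  antitone : AntitoneOn lam (Set.Iio N)
  eq_sum : T = ∑ k ∈ Finset.range N, lam k • ketBra (φ k)

/-- The absolute value `|T| = √(T* T)` of a bounded operator on a Hilbert space. -/
def operatorAbs {H : Type} [NormedAddCommGroup H] [InnerProductSpace ℂ H] [CompleteSpace H]
    (T : H →L[ℂ] H) : H →L[ℂ] H := CFC.abs T

/-- The trace norm `‖T‖₁ = tr |T| = ∑ⱼ ⟨j, |T| j⟩`, as an extended nonnegative real number (each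
summand is nonnegative since `|T|` is a positive operator). -/
def traceNorm (T : FockSpace →L[ℂ] FockSpace) : ENNReal :=
  ∑' j : ℕ, ENNReal.ofReal (inner ℂ (fockState j) (operatorAbs T (fockState j))).re

end

/-! ### Fock states and rank-one operators -/

/-! The Gaussian state is diagonal in the Fock basis: phase rotations kill its off-diagonal entries,
and a Gamma integral gives the diagonal ones. They are strictly decreasing, positive and sum to 1.

Because no trace is lost in the limit, weak convergence upgrades to operator norm
(`tendsto_constellationState`). Compressions to the first K Fock states converge entrywise, and a
coherent mixture differs from its compression by at most 2√(trace outside the compression). That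
trace converges to a tail of the thermal series, which is small for large K.

The spectral statement (`tendsto_spectralDecomposition`) goes by strong induction on k. After
subtracting the first k spectral terms, the norm of the remainder is exactly the next eigenvalue, so
the eigenvalues converge, and positivity of the limit forces N n > k. Each eigenvector is then an
approximate eigenvector of a diagonal operator with a spectral gap, so its component orthogonal to
|k⟩ vanishes. By `traceNorm_ketBra_sub`, twice the norm of this component is the required trace
norm. -/

theorem fockState_apply (i j : ℕ) : (fockState i : ℕ → ℂ) j = if j = i then 1 else 0 := by
  rcases eq_or_ne j i with rfl | h
  · simp [fockState]
  · simp [fockState, h]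

@[simp]
theorem inner_fockState_left (k : ℕ) (x : FockSpace) :
    inner ℂ (fockState k) x = (x : ℕ → ℂ) k := by
  simp [fockState, lp.inner_single_left]

theorem orthonormal_fockState : Orthonormal ℂ fockState := by
  rw [orthonormal_iff_ite]
  intro i j
  rw [inner_fockState_left, fockState_apply]

@[simp]
theorem norm_fockState (k : ℕ) : ‖fockState k‖ = 1 := orthonormal_fockState.1 k

theorem hasSum_norm_sq_apply (x : FockSpace) :
    HasSum (fun j => ‖(x : ℕ → ℂ) j‖ ^ 2) (‖x‖ ^ 2) := by
  simpa using lp.hasSum_norm (p := 2) (by simp) x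

theorem hasSum_smul_fockState (x : FockSpace) :
    HasSum (fun j => (x : ℕ → ℂ) j • fockState j) x := by
  have h := lp.hasSum_single (p := 2) (by simp) x
  have h' : ∀ j, (x : ℕ → ℂ) j • fockState j = lp.single 2 j ((x : ℕ → ℂ) j) := fun j => by
    rw [fockState, ← lp.single_smul, smul_eq_mul, mul_one]
  simpa only [h'] using h

theorem fockSpace_operator_ext {S T : FockSpace →L[ℂ] FockSpace}
    (h : ∀ i j, inner ℂ (fockState i) (S (fockState j)) = inner ℂ (fockState i) (T (fockState j))) :
    S = T := by
  have h' : ∀ j, S (fockState j) = T (fockState j) := fun j => by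
    ext i
    simpa using h i j
  ext1 x
  have hS := (hasSum_smul_fockState x).mapL S
  have hT := (hasSum_smul_fockState x).mapL T
  simp only [map_smul, h'] at hS hT
  exact hS.unique hT

theorem real_smul_apply (r : ℝ) (T : FockSpace →L[ℂ] FockSpace) (x : FockSpace) :
    (r • T) x = (r : ℂ) • T x :=
  RCLike.real_smul_eq_coe_smul (K := ℂ) r (T x)

theorem ketBra_apply (x y : FockSpace) : ketBra x y = inner ℂ x y • x := rfl

@[simp]
theorem norm_ketBra (x : FockSpace) : ‖ketBra x‖ = ‖x‖ ^ 2 := by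
  simp [ketBra, sq]

theorem norm_ketBra_sub_ketBra_le (x y : FockSpace) :
    ‖ketBra x - ketBra y‖ ≤ ‖x - y‖ * (‖x‖ + ‖y‖) := by
  have h : ketBra x - ketBra y = InnerProductSpace.rankOne ℂ (x - y) x +
      InnerProductSpace.rankOne ℂ y (x - y) := by
    simp [ketBra]
  rw [h]
  refine (norm_add_le _ _).trans ?_
  simp only [InnerProductSpace.norm_rankOne]
  linarith [mul_comm ‖y‖ ‖x - y‖, mul_add ‖x - y‖ ‖x‖ ‖y‖]

theorem continuous_ketBra : Continuous ketBra := by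
  refine continuous_iff_continuousAt.2 fun y => tendsto_iff_norm_sub_tendsto_zero.2 ?_
  refine squeeze_zero (fun _ => norm_nonneg _) (fun x => norm_ketBra_sub_ketBra_le x y) ?_
  have h : Continuous fun x : FockSpace => ‖x - y‖ * (‖x‖ + ‖y‖) := by fun_prop
  simpa using h.tendsto y

theorem ketBra_smul (c : ℂ) (x : FockSpace) : ketBra (c • x) = (‖c‖ ^ 2 : ℝ) • ketBra x := by
  ext1 y
  rw [real_smul_apply, ketBra_apply, ketBra_apply, inner_smul_left, smul_smul,
    smul_smul, Complex.ofReal_pow, ← Complex.conj_mul']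
  congr 1
  ring

theorem inner_fockState_ketBra (i j : ℕ) (x : FockSpace) :
    inner ℂ (fockState i) (ketBra x (fockState j)) =
      (x : ℕ → ℂ) i * (starRingEnd ℂ) ((x : ℕ → ℂ) j) := by
  rw [ketBra_apply, inner_smul_right, ← inner_conj_symm x, inner_fockState_left,
    inner_fockState_left, mul_comm]

theorem sum_smul_ketBra_apply {ι : Type*} (s : Finset ι) (a : ι → ℝ) (v : ι → FockSpace)
    (x : FockSpace) :
    (∑ i ∈ s, a i • ketBra (v i)) x = ∑ i ∈ s, ((a i : ℂ) * inner ℂ (v i) x) • v i := by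
  simp only [sum_apply, real_smul_apply, ketBra_apply, mul_smul]

theorem norm_sum_smul_ketBra_le {ι : Type*} {v : ι → FockSpace} (hv : Orthonormal ℂ v)
    (s : Finset ι) {a : ι → ℝ} {C : ℝ} (hC : 0 ≤ C) (ha : ∀ i ∈ s, |a i| ≤ C) :
    ‖∑ i ∈ s, a i • ketBra (v i)‖ ≤ C := by
  refine ContinuousLinearMap.opNorm_le_bound _ hC fun x => ?_
  rw [sum_smul_ketBra_apply]
  refine le_of_sq_le_sq ?_ (by positivity)
  have h := hv.inner_sum (fun i => (a i : ℂ) * inner ℂ (v i) x)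
    (fun i => (a i : ℂ) * inner ℂ (v i) x) s
  rw [inner_self_eq_norm_sq_to_K] at h
  simp only [Complex.conj_mul'] at h
  have h' : ‖∑ i ∈ s, ((a i : ℂ) * inner ℂ (v i) x) • v i‖ ^ 2 =
      ∑ i ∈ s, ‖(a i : ℂ) * inner ℂ (v i) x‖ ^ 2 := by
    apply Complex.ofReal_injective
    push_cast
    exact h
  rw [h', mul_pow]
  refine le_trans ?_ (mul_le_mul_of_nonneg_left (hv.sum_inner_products_le x (s := s)) (sq_nonneg C))
  rw [Finset.mul_sum]
  refine Finset.sum_le_sum fun i hi => ?_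
  rw [norm_mul, mul_pow, Complex.norm_real, Real.norm_eq_abs]
  gcongr
  exact ha i hi

theorem sum_smul_ketBra_apply_self {ι : Type*} {v : ι → FockSpace} (hv : Orthonormal ℂ v)
    {s : Finset ι} (a : ι → ℝ) {i : ι} (hi : i ∈ s) :
    (∑ j ∈ s, a j • ketBra (v j)) (v i) = (a i : ℂ) • v i := by
  classical
  rw [sum_smul_ketBra_apply, Finset.sum_eq_single i, inner_self_eq_norm_sq_to_K, hv.1 i]
  · simp
  · intro j _ hji
    rw [hv.2 hji]
    simp
  · exact fun h => absurd hi h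

/-! ### The trace norm of a difference of two rank-one projections -/

theorem isSelfAdjoint_ketBra (x : FockSpace) : IsSelfAdjoint (ketBra x) := by
  rw [ContinuousLinearMap.isSelfAdjoint_iff_isSymmetric]
  intro y z
  simp only [ContinuousLinearMap.coe_coe, ketBra_apply, inner_smul_left, inner_smul_right,
    inner_conj_symm]
  ring

theorem ketBra_mul_ketBra_mul_ketBra (x y : FockSpace) :
    ketBra x * ketBra y * ketBra x = (‖inner ℂ x y‖ ^ 2 : ℝ) • ketBra x := by
  ext1 z
  simp only [mul_apply_eq_comp, real_smul_apply, ketBra_apply,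
    inner_smul_right, smul_smul]
  congr 1
  rw [Complex.ofReal_pow, ← Complex.conj_mul', inner_conj_symm]
  ring

theorem ketBra_mul_self {x : FockSpace} (hx : ‖x‖ = 1) : ketBra x * ketBra x = ketBra x := by
  ext1 z
  simp [ketBra_apply, inner_self_eq_norm_sq_to_K, hx]

/-- For rank-one projections P and Q, PQP and QPQ are the same multiple of P and Q. The cubic
relation confines the spectrum of P - Q to 0 and ±√(1 - |⟨x, y⟩|²), which determines |P - Q| without
diagonalizing. -/
theorem ketBra_sub_cube {x y : FockSpace} (hx : ‖x‖ = 1) (hy : ‖y‖ = 1) :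
    (ketBra x - ketBra y) * ((ketBra x - ketBra y) * (ketBra x - ketBra y)) =
      (1 - ‖inner ℂ x y‖ ^ 2 : ℝ) • (ketBra x - ketBra y) := by
  have h1 := ketBra_mul_ketBra_mul_ketBra x y
  have h2 := ketBra_mul_ketBra_mul_ketBra y x
  rw [norm_inner_symm] at h2
  have h3 := ketBra_mul_self hx
  have h4 := ketBra_mul_self hy
  generalize ketBra x = P at *
  generalize ketBra y = Q at *
  calc (P - Q) * ((P - Q) * (P - Q))
      = P * (P * P) - (P * P) * Q - P * Q * P + P * (Q * Q) - Q * (P * P) + Q * P * Q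
        + (Q * Q) * P - (Q * Q) * Q := by noncomm_ring
    _ = _ := by
      rw [h3, h4, h3, h4, h1, h2, sub_smul, one_smul, smul_sub]
      abel

/-- The cubic relation gives (D²)² = c D², so D²/√c is a nonnegative square root of D², and such a
root is unique. -/
theorem IsSelfAdjoint.cfcAbs_eq_of_cube {A : Type*} [CStarAlgebra A] [PartialOrder A]
    [StarOrderedRing A] {D : A} (hD : IsSelfAdjoint D) {c : ℝ} (hc : 0 ≤ c)
    (h3 : D * (D * D) = c • D) : CFC.abs D = (Real.sqrt c)⁻¹ • (D * D) := by
  have hnn : 0 ≤ D * D := by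
    have := star_mul_self_nonneg D
    rwa [hD.star_eq] at this
  refine CFC.sqrt_unique ?_ (smul_nonneg (by positivity) hnn)
  rw [hD.star_eq, smul_mul_smul_comm, ← mul_inv, Real.mul_self_sqrt hc,
    show D * D * (D * D) = D * (D * (D * D)) by noncomm_ring, h3, mul_smul_comm, smul_smul]
  -- For c = 0 the factor `(Real.sqrt c)⁻¹` is 0 by convention, so D² = 0 is needed; it follows from
  -- the C*-identity.
  rcases eq_or_ne c 0 with rfl | hne
  · have h0 : D * D * (D * D) = 0 := by
      rw [show D * D * (D * D) = D * (D * (D * D)) by noncomm_ring, h3]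
      simp
    have h1 : D * D = 0 := by
      have := CStarRing.norm_star_mul_self (x := D * D)
      rw [star_mul, hD.star_eq, h0, norm_zero] at this
      exact norm_eq_zero.1 (mul_self_eq_zero.1 this.symm)
    rw [h1, smul_zero]
  · rw [inv_mul_cancel₀ hne, one_smul]

theorem operatorAbs_ketBra_sub {x y : FockSpace} (hx : ‖x‖ = 1) (hy : ‖y‖ = 1) :
    operatorAbs (ketBra x - ketBra y) = (Real.sqrt (1 - ‖inner ℂ x y‖ ^ 2))⁻¹ •
      ((ketBra x - ketBra y) * (ketBra x - ketBra y)) := by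
  have hc : 0 ≤ 1 - ‖inner ℂ x y‖ ^ 2 := by
    have h := norm_inner_le_norm (𝕜 := ℂ) x y
    rw [hx, hy, one_mul] at h
    nlinarith [norm_nonneg (inner ℂ x y)]
  exact ((isSelfAdjoint_ketBra x).sub (isSelfAdjoint_ketBra y)).cfcAbs_eq_of_cube hc
    (ketBra_sub_cube hx hy)

/-- Since |D| = D²/√(1 - c), the trace of |D| is the squared Hilbert–Schmidt norm 2(1 - c) of D
divided by √(1 - c). -/
theorem traceNorm_ketBra_sub {x y : FockSpace} (hx : ‖x‖ = 1) (hy : ‖y‖ = 1) :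
    traceNorm (ketBra x - ketBra y) =
      ENNReal.ofReal (2 * Real.sqrt (1 - ‖inner ℂ x y‖ ^ 2)) := by
  have hD : IsSelfAdjoint (ketBra x - ketBra y) :=
    (isSelfAdjoint_ketBra x).sub (isSelfAdjoint_ketBra y)
  set c := ‖inner ℂ x y‖ ^ 2 with hc
  have hterm : ∀ j, (inner ℂ (fockState j) (operatorAbs (ketBra x - ketBra y) (fockState j))).re
      = (Real.sqrt (1 - c))⁻¹ * ‖(ketBra x - ketBra y) (fockState j)‖ ^ 2 := by
    intro j
    rw [operatorAbs_ketBra_sub hx hy, real_smul_apply,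
      inner_smul_right, Complex.re_ofReal_mul, mul_apply_eq_comp]
    congr 1
    have h := ContinuousLinearMap.isSelfAdjoint_iff_isSymmetric.1 hD (fockState j)
      ((ketBra x - ketBra y) (fockState j))
    simp only [ContinuousLinearMap.coe_coe] at h
    rw [← h, inner_self_eq_norm_sq_to_K]
    norm_cast
  have hval : ∀ j, ‖(ketBra x - ketBra y) (fockState j)‖ ^ 2 =
      ‖(x : ℕ → ℂ) j‖ ^ 2 + ‖(y : ℕ → ℂ) j‖ ^ 2 -
        2 * (inner ℂ ((x : ℕ → ℂ) j) ((y : ℕ → ℂ) j) * inner ℂ y x).re := by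
    intro j
    rw [sub_apply, ketBra_apply, ketBra_apply, ← inner_conj_symm x,
      ← inner_conj_symm y, inner_fockState_left, inner_fockState_left,
      @norm_sub_sq ℂ, norm_smul, norm_smul, hx, hy, inner_smul_left, inner_smul_right,
      ← Complex.conj_re (inner ℂ _ _ * _)]
    simp
    ring
  have hsum : HasSum (fun j => ‖(ketBra x - ketBra y) (fockState j)‖ ^ 2) (2 * (1 - c)) := by
    simp only [hval]
    have h := ((hasSum_norm_sq_apply x).add (hasSum_norm_sq_apply y)).sub
      ((Complex.hasSum_re ((lp.hasSum_inner x y).mul_right (inner ℂ y x))).mul_left 2)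
    have hre : (inner ℂ x y * inner ℂ y x).re = c := by
      rw [← inner_conj_symm y x, Complex.mul_conj', ← Complex.ofReal_pow, Complex.ofReal_re]
    rw [hre, hx, hy] at h
    rw [show 2 * (1 - c) = 1 ^ 2 + 1 ^ 2 - 2 * c by ring]
    exact h
  have hsum' := hsum.mul_left (Real.sqrt (1 - c))⁻¹
  rw [traceNorm]
  simp only [hterm]
  rw [← ENNReal.ofReal_tsum_of_nonneg (fun j => by positivity) hsum'.summable, hsum'.tsum_eq]
  congr 1
  rw [mul_left_comm, ← div_eq_inv_mul, Real.div_sqrt]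

/-! ### Coherent states and their Gaussian mixture -/

@[simp]
theorem coherentState_apply (z : ℂ) (k : ℕ) :
    (coherentState z : ℕ → ℂ) k = coherentCoeff z k := rfl

theorem norm_coherentCoeff_sq (z : ℂ) (k : ℕ) :
    ‖coherentCoeff z k‖ ^ 2 = Real.exp (-‖z‖ ^ 2) * ((‖z‖ ^ 2) ^ k / (k.factorial : ℝ)) := by
  have h2 : Real.sqrt (k.factorial : ℝ) ^ 2 = (k.factorial : ℝ) :=
    Real.sq_sqrt (Nat.cast_nonneg _)
  have h3 : Real.exp (-‖z‖ ^ 2 / 2) ^ 2 = Real.exp (-‖z‖ ^ 2) := by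
    rw [← Real.exp_nat_mul]
    congr 1
    push_cast
    ring
  simp only [coherentCoeff, norm_mul, norm_div, norm_pow, Complex.norm_real, Real.norm_eq_abs,
    mul_pow, div_pow, sq_abs, h2, h3]
  ring

@[simp]
theorem norm_coherentState (z : ℂ) : ‖coherentState z‖ = 1 := by
  have h := hasSum_norm_sq_apply (coherentState z)
  simp only [coherentState_apply, norm_coherentCoeff_sq] at h
  have h' : HasSum (fun k : ℕ => Real.exp (-‖z‖ ^ 2) * ((‖z‖ ^ 2) ^ k / (k.factorial : ℝ)))
      (Real.exp (-‖z‖ ^ 2) * Real.exp (‖z‖ ^ 2)) := by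
    rw [Real.exp_eq_exp_ℝ]
    exact (NormedSpace.expSeries_div_hasSum_exp (‖z‖ ^ 2)).mul_left _
  rw [← Real.exp_add, neg_add_cancel, Real.exp_zero] at h'
  have h1 := h.unique h'
  nlinarith [norm_nonneg (coherentState z)]

theorem continuous_coherentCoeff (k : ℕ) : Continuous fun z => coherentCoeff z k := by
  unfold coherentCoeff
  fun_prop

theorem stronglyMeasurable_coherentState : StronglyMeasurable coherentState := by
  refine stronglyMeasurable_of_tendsto atTop
    (f := fun n z => ∑ k ∈ Finset.range n, coherentCoeff z k • fockState k) (fun n => ?_) ?_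
  · refine Continuous.stronglyMeasurable (continuous_finsetSum _ fun k _ => ?_)
    exact (continuous_coherentCoeff k).smul continuous_const
  · exact tendsto_pi_nhds.2 fun z => (hasSum_smul_fockState (coherentState z)).tendsto_sum_nat

theorem integral_norm_pow_mul_exp_neg_mul_sq (k : ℕ) {b : ℝ} (hb : 0 < b) :
    ∫ z : ℂ, ‖z‖ ^ (2 * k) * Real.exp (-b * ‖z‖ ^ 2) =
      Real.pi * k.factorial / b ^ (k + 1) := by
  have h := Complex.integral_rpow_mul_exp_neg_mul_rpow (p := 2) (q := ((2 * k : ℕ) : ℝ)) (b := b)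
    (by norm_num) (lt_of_lt_of_le (by norm_num) (Nat.cast_nonneg _)) hb
  simp only [Real.rpow_natCast, Real.rpow_two] at h
  rw [h, show (((2 * k : ℕ) : ℝ) + 2) / 2 = (k : ℝ) + 1 by push_cast; ring,
    show -(((2 * k : ℕ) : ℝ) + 2) / 2 = -((k + 1 : ℕ) : ℝ) by push_cast; ring,
    Real.Gamma_nat_eq_factorial, Real.rpow_neg hb.le, Real.rpow_natCast]
  field_simp

theorem integrable_exp_neg_mul_norm_sq {b : ℝ} (hb : 0 < b) :
    Integrable fun z : ℂ => Real.exp (-b * ‖z‖ ^ 2) := by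
  -- A non-integrable function has Bochner integral 0, so the nonzero value already computed proves
  -- integrability.
  refine Integrable.of_integral_ne_zero ?_
  have h := integral_norm_pow_mul_exp_neg_mul_sq 0 hb
  simp only [mul_zero, pow_zero, one_mul] at h
  rw [h]
  positivity

theorem isFiniteMeasure_complexGaussian {m : ℝ} (hm : 0 < m) :
    IsFiniteMeasure (complexGaussian m) := by
  refine isFiniteMeasure_withDensity_ofReal (Integrable.hasFiniteIntegral ?_)
  have h := (integrable_exp_neg_mul_norm_sq (inv_pos.2 hm)).div_const (Real.pi * m)
  have hz : ∀ z : ℂ, -m⁻¹ * ‖z‖ ^ 2 = -‖z‖ ^ 2 / m := fun z => by ring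
  simpa only [hz] using h

theorem integral_complexGaussian {m : ℝ} (hm : 0 < m) (f : ℂ → ℂ) :
    ∫ z, f z ∂(complexGaussian m) =
      ∫ z, (Real.exp (-(‖z‖ ^ 2) / m) / (Real.pi * m)) • f z := by
  rw [complexGaussian, integral_withDensity_eq_integral_toReal_smul]
  · refine integral_congr_ae (Eventually.of_forall fun z => ?_)
    simp only
    rw [ENNReal.toReal_ofReal (by positivity)]
  · fun_prop
  · exact Eventually.of_forall fun z => ENNReal.ofReal_lt_top

theorem integral_coherentCoeff_mul_conj_self {m : ℝ} (hm : 0 < m) (k : ℕ) :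
    ∫ z, coherentCoeff z k * (starRingEnd ℂ) (coherentCoeff z k) ∂(complexGaussian m) =
      thermalEigenvalue m k := by
  have hb : 0 < 1 + m⁻¹ := by positivity
  rw [integral_complexGaussian hm]
  have h : ∀ z : ℂ, (Real.exp (-(‖z‖ ^ 2) / m) / (Real.pi * m)) •
      (coherentCoeff z k * (starRingEnd ℂ) (coherentCoeff z k)) =
      (((Real.pi * m * k.factorial)⁻¹ * (‖z‖ ^ (2 * k) *
        Real.exp (-(1 + m⁻¹) * ‖z‖ ^ 2)) : ℝ) : ℂ) := by
    intro z
    rw [Complex.mul_conj', ← Complex.ofReal_pow, norm_coherentCoeff_sq, Complex.real_smul,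
      ← Complex.ofReal_mul]
    congr 1
    rw [show -(1 + m⁻¹) * ‖z‖ ^ 2 = -(‖z‖ ^ 2) / m + -‖z‖ ^ 2 by ring, Real.exp_add, pow_mul]
    have : (k.factorial : ℝ) ≠ 0 := by positivity
    field_simp
  simp only [h]
  rw [integral_complex_ofReal, integral_const_mul, integral_norm_pow_mul_exp_neg_mul_sq k hb,
    thermalEigenvalue]
  congr 1
  have : (k.factorial : ℝ) ≠ 0 := by positivity
  rw [show 1 + m⁻¹ = (m + 1) / m by field_simp, div_pow]
  field_simp
  ring

theorem integral_coherentCoeff_mul_conj_of_ne {m : ℝ} (hm : 0 < m) {i j : ℕ} (hij : i ≠ j) :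
    ∫ z, coherentCoeff z i * (starRingEnd ℂ) (coherentCoeff z j) ∂(complexGaussian m) = 0 := by
  rw [integral_complexGaussian hm]
  set f : ℂ → ℂ := fun z => (Real.exp (-(‖z‖ ^ 2) / m) / (Real.pi * m)) •
    (coherentCoeff z i * (starRingEnd ℂ) (coherentCoeff z j)) with hf
  -- Rotation by θ multiplies the integrand by exp(iθ(i - j)) = -1 (with the first i imaginary) and
  -- preserves Lebesgue measure, so the integral equals its own negative.
  set θ : ℝ := Real.pi / ((i : ℝ) - j) with hθ
  have hd : (i : ℝ) - j ≠ 0 := sub_ne_zero.2 (Nat.cast_injective.ne hij)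
  have hc : (Circle.exp θ : ℂ) ^ i * (starRingEnd ℂ) (Circle.exp θ : ℂ) ^ j = -1 := by
    rw [Circle.coe_exp, ← Complex.exp_conj, ← Complex.exp_nat_mul, ← Complex.exp_nat_mul,
      ← Complex.exp_add, ← Complex.exp_pi_mul_I]
    congr 1
    rw [map_mul, Complex.conj_I, Complex.conj_ofReal]
    have h : ((i : ℂ) - j) * θ = Real.pi := by
      rw [hθ, ← Complex.ofReal_natCast, ← Complex.ofReal_natCast, ← Complex.ofReal_sub,
        ← Complex.ofReal_mul, mul_div_cancel₀ _ hd]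
    rw [← h]
    ring
  have hrot : ∀ z, f (rotation (Circle.exp θ) z) = -f z := by
    intro z
    simp only [hf, rotation_apply, coherentCoeff, norm_mul, Circle.norm_coe, one_mul, map_mul,
      map_div₀, map_pow, mul_pow]
    rw [← mul_neg_one (_ • _), ← hc]
    simp only [Complex.real_smul]
    ring
  have h := (rotation (Circle.exp θ)).measurePreserving.integral_comp
    (rotation (Circle.exp θ)).toHomeomorph.measurableEmbedding f
  simp only [hrot, integral_neg] at h
  exact self_eq_neg.1 h.symm

theorem integrable_ketBra_coherentState {m : ℝ} (hm : 0 < m) :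
    Integrable (fun z => ketBra (coherentState z)) (complexGaussian m) := by
  have := isFiniteMeasure_complexGaussian hm
  refine Integrable.of_bound
    (continuous_ketBra.comp_stronglyMeasurable
      stronglyMeasurable_coherentState).aestronglyMeasurable 1 ?_
  exact Eventually.of_forall fun z => by simp

theorem inner_fockState_gaussianState {m : ℝ} (hm : 0 < m) (i j : ℕ) :
    inner ℂ (fockState i) (gaussianState m (fockState j)) =
      if i = j then (thermalEigenvalue m j : ℂ) else 0 := by
  let L : (FockSpace →L[ℂ] FockSpace) →L[ℂ] ℂ :=
    (innerSL ℂ (fockState i)).comp (ContinuousLinearMap.apply ℂ FockSpace (fockState j))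
  have hL : ∀ T, L T = inner ℂ (fockState i) (T (fockState j)) := fun _ => rfl
  have h := L.integral_comp_comm (integrable_ketBra_coherentState hm)
  rw [← hL, gaussianState, ← h]
  simp only [hL, inner_fockState_ketBra, coherentState_apply]
  split_ifs with hij
  · subst hij
    exact integral_coherentCoeff_mul_conj_self hm i
  · exact integral_coherentCoeff_mul_conj_of_ne hm hij

theorem thermalEigenvalue_pos {m : ℝ} (hm : 0 < m) (k : ℕ) : 0 < thermalEigenvalue m k := by
  rw [thermalEigenvalue]
  positivity

theorem thermalEigenvalue_eq {m : ℝ} (hm : 0 < m) (k : ℕ) :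
    thermalEigenvalue m k = (m + 1)⁻¹ * (m / (m + 1)) ^ k := by
  rw [thermalEigenvalue, div_pow, pow_succ]
  field_simp

theorem strictAnti_thermalEigenvalue {m : ℝ} (hm : 0 < m) : StrictAnti (thermalEigenvalue m) := by
  refine strictAnti_nat_of_succ_lt fun k => ?_
  rw [thermalEigenvalue_eq hm, thermalEigenvalue_eq hm, pow_succ]
  have h1 : m / (m + 1) < 1 := by rw [div_lt_one (by positivity)]; linarith
  have h2 : 0 < (m + 1)⁻¹ * (m / (m + 1)) ^ k := by positivity
  nlinarith

theorem hasSum_thermalEigenvalue {m : ℝ} (hm : 0 < m) : HasSum (thermalEigenvalue m) 1 := by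
  have h1 : m / (m + 1) < 1 := by rw [div_lt_one (by positivity)]; linarith
  have h := (hasSum_geometric_of_lt_one (by positivity) h1).mul_left (m + 1)⁻¹
  simp only [← thermalEigenvalue_eq hm] at h
  have h2 : (m + 1)⁻¹ * (1 - m / (m + 1))⁻¹ = 1 := by
    rw [one_sub_div (by positivity), add_sub_cancel_left]
    field_simp
  rwa [h2] at h

theorem hasSum_thermalEigenvalue_smul_ketBra {m : ℝ} (hm : 0 < m) :
    HasSum (fun k => thermalEigenvalue m k • ketBra (fockState k)) (gaussianState m) := by
  have hs : Summable fun k => thermalEigenvalue m k • ketBra (fockState k) := by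
    refine (hasSum_thermalEigenvalue hm).summable.of_norm_bounded fun k => ?_
    rw [norm_smul, norm_ketBra, norm_fockState, Real.norm_of_nonneg (thermalEigenvalue_pos hm k).le]
    simp
  have h := hs.hasSum
  suffices hS : ∑' k, thermalEigenvalue m k • ketBra (fockState k) = gaussianState m by
    rwa [hS] at h
  refine fockSpace_operator_ext fun i j => ?_
  rw [inner_fockState_gaussianState hm]
  have h' := (h.mapL (ContinuousLinearMap.apply ℂ FockSpace (fockState j))).mapL
    (innerSL ℂ (fockState i))
  simp only [ContinuousLinearMap.apply_apply, innerSL_apply_apply] at h'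
  have hterm : ∀ k, inner ℂ (fockState i)
      ((thermalEigenvalue m k • ketBra (fockState k)) (fockState j)) =
        if k = i then (if i = j then (thermalEigenvalue m j : ℂ) else 0) else 0 := by
    intro k
    rw [real_smul_apply, inner_smul_right, inner_fockState_ketBra, fockState_apply, fockState_apply]
    rcases eq_or_ne k i with rfl | h1
    · rcases eq_or_ne k j with rfl | h2
      · simp
      · simp [h2, h2.symm]
    · simp [h1, h1.symm]
  simp only [hterm] at h'
  exact h'.unique (hasSum_ite_eq i _)

/-! ### Weak convergence of coherent-state mixtures implies norm convergence -/

/-- The orthogonal projection onto the span of the first `K` Fock states. -/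
noncomputable def fockProjection (K : ℕ) : FockSpace →L[ℂ] FockSpace :=
  ∑ j ∈ Finset.range K, (1 : ℝ) • ketBra (fockState j)

theorem fockProjection_apply (K : ℕ) (x : FockSpace) :
    fockProjection K x = ∑ j ∈ Finset.range K, (x : ℕ → ℂ) j • fockState j := by
  simp [fockProjection, ketBra_apply]

theorem norm_fockProjection_le (K : ℕ) : ‖fockProjection K‖ ≤ 1 :=
  norm_sum_smul_ketBra_le orthonormal_fockState _ zero_le_one fun _ _ => by simp

theorem isSelfAdjoint_fockProjection (K : ℕ) : IsSelfAdjoint (fockProjection K) := by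
  refine isSelfAdjoint_sum _ fun j _ => ?_
  rw [one_smul]
  exact isSelfAdjoint_ketBra _

theorem norm_sub_sum_smul_fockState_sq (x : FockSpace) (s : Finset ℕ) :
    ‖x - ∑ j ∈ s, (x : ℕ → ℂ) j • fockState j‖ ^ 2 =
      ‖x‖ ^ 2 - ∑ j ∈ s, ‖(x : ℕ → ℂ) j‖ ^ 2 := by
  have h := lp.norm_compl_sum_single (p := 2) (by simp) x s
  have h' : ∀ j, (x : ℕ → ℂ) j • fockState j = lp.single 2 j ((x : ℕ → ℂ) j) := fun j => by
    rw [fockState, ← lp.single_smul, smul_eq_mul, mul_one]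
  simpa [h'] using h

theorem fockProjection_mul_ketBra_mul (K : ℕ) (x : FockSpace) :
    fockProjection K * ketBra x * fockProjection K = ketBra (fockProjection K x) := by
  ext1 y
  have h := ContinuousLinearMap.isSelfAdjoint_iff_isSymmetric.1 (isSelfAdjoint_fockProjection K) x y
  simp only [ContinuousLinearMap.coe_coe] at h
  simp only [mul_apply_eq_comp, ketBra_apply, map_smul, h]

theorem norm_ketBra_sub_compression_le (K : ℕ) {x : FockSpace} (hx : ‖x‖ = 1) :
    ‖ketBra x - fockProjection K * ketBra x * fockProjection K‖ ≤
      2 * ‖x - fockProjection K x‖ := by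
  rw [fockProjection_mul_ketBra_mul]
  refine (norm_ketBra_sub_ketBra_le _ _).trans ?_
  have h : ‖fockProjection K x‖ ≤ 1 := by
    simpa [hx] using (fockProjection K).le_of_opNorm_le (norm_fockProjection_le K) x
  rw [hx]
  nlinarith [norm_nonneg (x - fockProjection K x)]

theorem re_inner_constellationState (X : Constellation) (y : FockSpace) :
    (inner ℂ y (X.state y)).re =
      ∑ x ∈ X.alphabet, X.prob x * ‖inner ℂ (coherentState x) y‖ ^ 2 := by
  rw [Constellation.state, sum_smul_ketBra_apply, inner_sum, Complex.re_sum]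
  refine Finset.sum_congr rfl fun x _ => ?_
  rw [inner_smul_right, mul_assoc, ← inner_conj_symm y, Complex.mul_conj', Complex.re_ofReal_mul,
    ← Complex.ofReal_pow, Complex.ofReal_re]

/-- Average the pure-state bound over the alphabet, then apply Jensen and Pythagoras. The result
involves only finitely many diagonal entries, which weak convergence controls. -/
theorem norm_constellationState_sub_compression_le (X : Constellation) (K : ℕ) :
    ‖X.state - fockProjection K * X.state * fockProjection K‖ ≤
      2 * Real.sqrt (1 - ∑ j ∈ Finset.range K,
        (inner ℂ (fockState j) (X.state (fockState j))).re) := by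
  have hsub : X.state - fockProjection K * X.state * fockProjection K =
      ∑ x ∈ X.alphabet, X.prob x • (ketBra (coherentState x) -
        fockProjection K * ketBra (coherentState x) * fockProjection K) := by
    simp only [Constellation.state, Finset.mul_sum, Finset.sum_mul, ← Finset.sum_sub_distrib,
      smul_sub, mul_smul_comm, smul_mul_assoc]
  have hmean : ∑ x ∈ X.alphabet, X.prob x * ‖coherentState x - fockProjection K (coherentState x)‖
      ≤ Real.sqrt (1 - ∑ j ∈ Finset.range K,
        (inner ℂ (fockState j) (X.state (fockState j))).re) := by
    refine Real.le_sqrt_of_sq_le ?_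
    refine (Real.pow_arith_mean_le_arith_mean_pow _ _ _ X.prob_nonneg X.prob_sum
      (fun _ _ => norm_nonneg _) 2).trans (le_of_eq ?_)
    simp only [fockProjection_apply, norm_sub_sum_smul_fockState_sq, norm_coherentState,
      re_inner_constellationState, mul_sub, Finset.sum_sub_distrib, one_pow, mul_one, X.prob_sum]
    rw [Finset.sum_comm]
    simp only [Finset.mul_sum]
    congr 1
    refine Finset.sum_congr rfl fun x _ => Finset.sum_congr rfl fun j _ => ?_
    rw [norm_inner_symm, inner_fockState_left]
  rw [hsub]
  refine (norm_sum_le _ _).trans ?_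
  refine le_trans (Finset.sum_le_sum (g := fun x => 2 * (X.prob x *
    ‖coherentState x - fockProjection K (coherentState x)‖)) fun x hx => ?_) ?_
  · rw [norm_smul, Real.norm_of_nonneg (X.prob_nonneg x hx)]
    have := norm_ketBra_sub_compression_le K (norm_coherentState x)
    nlinarith [X.prob_nonneg x hx]
  · rw [← Finset.mul_sum]
    gcongr

theorem compression_eq_sum (K : ℕ) (T : FockSpace →L[ℂ] FockSpace) :
    fockProjection K * T * fockProjection K =
      ∑ i ∈ Finset.range K, ∑ j ∈ Finset.range K,
        (inner ℂ (fockState i) (T (fockState j)) : ℂ) •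
          InnerProductSpace.rankOne ℂ (fockState i) (fockState j) := by
  ext1 x
  simp only [mul_apply_eq_comp, fockProjection_apply, map_sum, map_smul, sum_apply, smul_apply,
    InnerProductSpace.rankOne_apply, inner_fockState_left]
  rw [Finset.sum_comm]
  refine Finset.sum_congr rfl fun j _ => ?_
  rw [Finset.smul_sum]
  refine Finset.sum_congr rfl fun i _ => ?_
  rw [smul_smul, smul_smul, mul_comm]

theorem WeaklyConverges.tendsto_compression {ρ : ℕ → FockSpace →L[ℂ] FockSpace}
    {σ : FockSpace →L[ℂ] FockSpace} (h : WeaklyConverges ρ σ) (K : ℕ) :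
    Tendsto (fun n => fockProjection K * ρ n * fockProjection K) atTop
      (𝓝 (fockProjection K * σ * fockProjection K)) := by
  simp only [compression_eq_sum]
  exact tendsto_finsetSum _ fun i _ => tendsto_finsetSum _ fun j _ => (h _ _).smul_const _

theorem gaussianState_compression {m : ℝ} (hm : 0 < m) (K : ℕ) :
    fockProjection K * gaussianState m * fockProjection K =
      ∑ j ∈ Finset.range K, thermalEigenvalue m j • ketBra (fockState j) := by
  rw [compression_eq_sum]
  refine Finset.sum_congr rfl fun i hi => ?_
  rw [Finset.sum_eq_single_of_mem i hi]
  · rw [inner_fockState_gaussianState hm, if_pos rfl, ketBra]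
    exact (RCLike.real_smul_eq_coe_smul (K := ℂ) _ _).symm
  · intro j _ hji
    rw [inner_fockState_gaussianState hm, if_neg hji.symm, zero_smul]

theorem tendsto_constellationState {m : ℝ} (hm : 0 < m) {X : ℕ → Constellation}
    (hX : WeaklyConverges (fun n => (X n).state) (gaussianState m)) :
    Tendsto (fun n => (X n).state) atTop (𝓝 (gaussianState m)) := by
  rw [tendsto_iff_norm_sub_tendsto_zero]
  -- The limit, for fixed K, of the three-term bound in `hb`; the 0 is the limit of the difference
  -- of compressions.
  let c : ℕ → ℝ := fun K => 2 * Real.sqrt (1 - ∑ j ∈ Finset.range K, thermalEigenvalue m j) + 0 +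
    ‖fockProjection K * gaussianState m * fockProjection K - gaussianState m‖
  have hc : Tendsto c atTop (𝓝 0) := by
    have h1 := ((hasSum_thermalEigenvalue hm).tendsto_sum_nat.const_sub 1).sqrt.const_mul 2
    have h2 := tendsto_iff_norm_sub_tendsto_zero.1
      (hasSum_thermalEigenvalue_smul_ketBra hm).tendsto_sum_nat
    simp only [← gaussianState_compression hm] at h2
    simpa [c] using h1.add h2
  have hb : ∀ K, Tendsto (fun n => 2 * Real.sqrt (1 - ∑ j ∈ Finset.range K,
      (inner ℂ (fockState j) ((X n).state (fockState j))).re) +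
      ‖fockProjection K * (X n).state * fockProjection K -
        fockProjection K * gaussianState m * fockProjection K‖ +
      ‖fockProjection K * gaussianState m * fockProjection K - gaussianState m‖) atTop
      (𝓝 (c K)) := by
    intro K
    refine Tendsto.add_const _ (Tendsto.add ?_
      (tendsto_iff_norm_sub_tendsto_zero.1 (hX.tendsto_compression K)))
    refine ((Tendsto.const_sub 1 (tendsto_finsetSum _ fun j _ => ?_)).sqrt).const_mul 2
    have h := (Complex.continuous_re.tendsto _).comp (hX (fockState j) (fockState j))
    rwa [inner_fockState_gaussianState hm, if_pos rfl, Complex.ofReal_re] at h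
  refine (tendsto_order.2 ⟨fun a ha => Eventually.of_forall fun n => ha.trans_le (norm_nonneg _), fun ε hε => ?_⟩)
  obtain ⟨K, hK⟩ := (hc.eventually_lt_const hε).exists
  filter_upwards [(hb K).eventually_lt_const hK] with n hn
  refine lt_of_le_of_lt ?_ hn
  refine (norm_sub_le_norm_sub_add_norm_sub _
    (fockProjection K * gaussianState m * fockProjection K) _).trans ?_
  gcongr
  refine (norm_sub_le_norm_sub_add_norm_sub _
    (fockProjection K * (X n).state * fockProjection K) _).trans ?_
  gcongr
  exact norm_constellationState_sub_compression_le (X n) K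

/-! ### Convergence of eigenvalues and eigenprojections -/

theorem norm_sum_smul_ketBra_eq {ι : Type*} {v : ι → FockSpace} (hv : Orthonormal ℂ v)
    {s : Finset ι} {a : ι → ℝ} {i : ι} (hi : i ∈ s) (ha : ∀ j ∈ s, |a j| ≤ a i) :
    ‖∑ j ∈ s, a j • ketBra (v j)‖ = a i := by
  have h0 : 0 ≤ a i := (abs_nonneg _).trans (ha i hi)
  refine le_antisymm (norm_sum_smul_ketBra_le hv s h0 ha) ?_
  have h := (∑ j ∈ s, a j • ketBra (v j)).le_opNorm (v i)
  rwa [sum_smul_ketBra_apply_self hv a hi, norm_smul, hv.1 i, mul_one, mul_one, Complex.norm_real,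
    Real.norm_of_nonneg h0] at h

namespace IsSpectralDecomposition

variable {T : FockSpace →L[ℂ] FockSpace} {N : ℕ} {lam : ℕ → ℝ} {φ : ℕ → FockSpace}

theorem norm_eq_one (h : IsSpectralDecomposition T N lam φ) {k : ℕ} (hk : k < N) : ‖φ k‖ = 1 :=
  h.orthonormal.1 ⟨k, hk⟩

theorem apply_eigenvector (h : IsSpectralDecomposition T N lam φ) {k : ℕ} (hk : k < N) :
    T (φ k) = (lam k : ℂ) • φ k := by
  have h' := sum_smul_ketBra_apply_self h.orthonormal (fun i : Fin N => lam i)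
    (Finset.mem_univ ⟨k, hk⟩)
  rw [← Finset.sum_range fun i => lam i • ketBra (φ i), ← h.eq_sum] at h'
  exact h'

/-- This expresses an eigenvalue as an operator norm, hence as a norm-continuous quantity.
Nonnegativity keeps a large negative eigenvalue from dominating the remainder. -/
theorem norm_sub_sum_eq (h : IsSpectralDecomposition T N lam φ) (h0 : ∀ i < N, 0 ≤ lam i) {k : ℕ}
    (hk : k < N) : ‖T - ∑ i ∈ Finset.range k, lam i • ketBra (φ i)‖ = lam k := by
  -- Padding with zero coefficients keeps the full index range, where orthonormality is available.
  have hT : T - ∑ i ∈ Finset.range k, lam i • ketBra (φ i) =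
      ∑ i ∈ Finset.range N, (if k ≤ i then lam i else 0) • ketBra (φ i) := by
    have hz : ∑ i ∈ Finset.range k, (if k ≤ i then lam i else 0) • ketBra (φ i) = 0 :=
      Finset.sum_eq_zero fun i hi => by rw [if_neg (Finset.mem_range.1 hi).not_ge, zero_smul]
    rw [h.eq_sum, ← Finset.sum_Ico_eq_sub _ hk.le, ← Finset.sum_range_add_sum_Ico
      (fun i => (if k ≤ i then lam i else 0) • ketBra (φ i)) hk.le, hz, zero_add]
    refine Finset.sum_congr rfl fun i hi => ?_
    rw [if_pos (Finset.mem_Ico.1 hi).1]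
  rw [hT, Finset.sum_range fun i => (if k ≤ i then lam i else 0) • ketBra (φ i),
    norm_sum_smul_ketBra_eq h.orthonormal (a := fun i : Fin N => if k ≤ i then lam i else 0)
      (Finset.mem_univ ⟨k, hk⟩)]
  · exact if_pos le_rfl
  · intro j _
    simp only [le_refl, if_true]
    split_ifs with hj
    · rw [abs_of_nonneg (h0 j j.2)]
      exact h.antitone hk j.2 hj
    · simpa using h0 k hk

end IsSpectralDecomposition

theorem IsSpectralDecomposition.nonneg_of_state {X : Constellation} {N : ℕ} {lam : ℕ → ℝ}
    {φ : ℕ → FockSpace} (h : IsSpectralDecomposition X.state N lam φ) {k : ℕ} (hk : k < N) :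
    0 ≤ lam k := by
  have h1 := re_inner_constellationState X (φ k)
  rw [h.apply_eigenvector hk, inner_smul_right, inner_self_eq_norm_sq_to_K, h.norm_eq_one hk] at h1
  simp only [RCLike.ofReal_one, one_pow, mul_one, Complex.ofReal_re] at h1
  rw [h1]
  exact Finset.sum_nonneg fun x hx => mul_nonneg (X.prob_nonneg x hx) (sq_nonneg _)

theorem norm_gaussianState_sub_sum {m : ℝ} (hm : 0 < m) (k : ℕ) :
    ‖gaussianState m - ∑ i ∈ Finset.range k, thermalEigenvalue m i • ketBra (fockState i)‖ =
      thermalEigenvalue m k := by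
  have h := ((hasSum_thermalEigenvalue_smul_ketBra hm).tendsto_sum_nat.sub_const
    (∑ i ∈ Finset.range k, thermalEigenvalue m i • ketBra (fockState i))).norm
  refine tendsto_nhds_unique h (tendsto_const_nhds.congr' ?_)
  filter_upwards [eventually_gt_atTop k] with n hn
  rw [← Finset.sum_Ico_eq_sub _ hn.le,
    norm_sum_smul_ketBra_eq orthonormal_fockState (Finset.left_mem_Ico.2 hn)]
  intro j hj
  rw [abs_of_pos (thermalEigenvalue_pos hm j)]
  exact (strictAnti_thermalEigenvalue hm).antitone (Finset.mem_Ico.1 hj).1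

theorem gaussianState_apply {m : ℝ} (hm : 0 < m) (x : FockSpace) (j : ℕ) :
    (gaussianState m x : ℕ → ℂ) j = thermalEigenvalue m j * (x : ℕ → ℂ) j := by
  have h := ((hasSum_smul_fockState x).mapL (gaussianState m)).mapL (innerSL ℂ (fockState j))
  simp only [innerSL_apply_apply, map_smul, inner_fockState_gaussianState hm] at h
  rw [inner_fockState_left] at h
  have hterm : ∀ i, (x : ℕ → ℂ) i • (if j = i then (thermalEigenvalue m i : ℂ) else 0) =
      if i = j then (thermalEigenvalue m j : ℂ) * (x : ℕ → ℂ) j else 0 := by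
    intro i
    rcases eq_or_ne i j with rfl | hij
    · simp [mul_comm]
    · simp [hij, hij.symm]
  simp only [hterm] at h
  exact h.unique (hasSum_ite_eq j _)

/-- By monotonicity the nearest eigenvalue is an adjacent one; for k = 0 there is only the right
neighbour. -/
theorem exists_spectralGap {m : ℝ} (hm : 0 < m) (k : ℕ) :
    ∃ g > 0, ∀ j ≠ k, g ≤ |thermalEigenvalue m j - thermalEigenvalue m k| := by
  have ha := strictAnti_thermalEigenvalue hm
  have hright : ∀ j > k, thermalEigenvalue m k - thermalEigenvalue m (k + 1) ≤
      |thermalEigenvalue m j - thermalEigenvalue m k| := by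
    intro j hj
    rw [abs_sub_comm]
    exact (sub_le_sub_left (ha.antitone hj) _).trans (le_abs_self _)
  have hpos := sub_pos.2 (ha (Nat.lt_succ_self k))
  rcases k with _ | k
  · exact ⟨_, hpos, fun j hj => hright j (Nat.pos_of_ne_zero hj)⟩
  · refine ⟨_, lt_min hpos (sub_pos.2 (ha (Nat.lt_succ_self k))), fun j hj => ?_⟩
    rcases hj.lt_or_gt with h | h
    · exact (min_le_right _ _).trans ((sub_le_sub_right (ha.antitone (Nat.lt_succ_iff.1 h)) _).trans
        (le_abs_self _))
    · exact (min_le_left _ _).trans (hright j h)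

/-- The shifted operator multiplies coordinate j by the difference of the j-th and k-th eigenvalues,
so the bound holds coordinate by coordinate. -/
theorem mul_norm_sub_smul_fockState_le {m : ℝ} (hm : 0 < m) {k : ℕ} {g : ℝ} (hg0 : 0 ≤ g)
    (hg : ∀ j ≠ k, g ≤ |thermalEigenvalue m j - thermalEigenvalue m k|) (x : FockSpace) :
    g * ‖x - (x : ℕ → ℂ) k • fockState k‖ ≤
      ‖gaussianState m x - (thermalEigenvalue m k : ℂ) • x‖ := by
  have h : ‖(g : ℂ) • (x - (x : ℕ → ℂ) k • fockState k)‖ ≤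
      ‖gaussianState m x - (thermalEigenvalue m k : ℂ) • x‖ := by
    refine lp.norm_mono (by norm_num) fun j => ?_
    simp only [lp.coeFn_smul, lp.coeFn_sub, Pi.smul_apply, Pi.sub_apply, gaussianState_apply hm,
      smul_eq_mul, fockState_apply]
    rw [← sub_mul, norm_mul, norm_mul, ← Complex.ofReal_sub, Complex.norm_real, Complex.norm_real,
      Real.norm_of_nonneg hg0, Real.norm_eq_abs]
    rcases eq_or_ne j k with rfl | hj
    · simp
    · simp only [hj, if_false, mul_zero, sub_zero]
      gcongr
      exact hg j hj
  rwa [norm_smul, Complex.norm_real, Real.norm_of_nonneg hg0] at h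

theorem norm_sub_smul_fockState_sq (x : FockSpace) (k : ℕ) :
    ‖x - (x : ℕ → ℂ) k • fockState k‖ ^ 2 = ‖x‖ ^ 2 - ‖(x : ℕ → ℂ) k‖ ^ 2 := by
  simpa using norm_sub_sum_smul_fockState_sq x {k}

/-- Let d be the norm on the right. Passing through the projected vector costs at most 2d, and
normalizing it costs d² ≤ d. -/
theorem norm_ketBra_sub_ketBra_fockState_le {x : FockSpace} (hx : ‖x‖ = 1) (k : ℕ) :
    ‖ketBra x - ketBra (fockState k)‖ ≤ 3 * ‖x - (x : ℕ → ℂ) k • fockState k‖ := by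
  have hsq := norm_sub_smul_fockState_sq x k
  rw [hx, one_pow] at hsq
  have hle : ‖(x : ℕ → ℂ) k‖ ≤ 1 := by
    nlinarith [norm_nonneg ((x : ℕ → ℂ) k), sq_nonneg ‖x - (x : ℕ → ℂ) k • fockState k‖]
  have hle' : ‖x - (x : ℕ → ℂ) k • fockState k‖ ≤ 1 := by
    nlinarith [norm_nonneg (x - (x : ℕ → ℂ) k • fockState k), sq_nonneg ‖(x : ℕ → ℂ) k‖]
  refine (norm_sub_le_norm_sub_add_norm_sub _ (ketBra ((x : ℕ → ℂ) k • fockState k)) _).trans ?_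
  have h1 := norm_ketBra_sub_ketBra_le x ((x : ℕ → ℂ) k • fockState k)
  rw [hx, norm_smul, norm_fockState, mul_one] at h1
  have h2 : ‖ketBra ((x : ℕ → ℂ) k • fockState k) - ketBra (fockState k)‖ =
      ‖x - (x : ℕ → ℂ) k • fockState k‖ ^ 2 := by
    have h3 : ketBra ((x : ℕ → ℂ) k • fockState k) - ketBra (fockState k) =
        (‖(x : ℕ → ℂ) k‖ ^ 2 - 1) • ketBra (fockState k) := by
      rw [ketBra_smul, sub_smul, one_smul]
    rw [h3, norm_smul, norm_ketBra, norm_fockState, one_pow, mul_one, Real.norm_eq_abs,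
      abs_sub_comm, ← hsq, abs_of_nonneg (sq_nonneg _)]
  rw [h2]
  nlinarith [norm_nonneg (x - (x : ℕ → ℂ) k • fockState k)]

theorem traceNorm_ketBra_sub_ketBra_fockState {x : FockSpace} (hx : ‖x‖ = 1) (k : ℕ) :
    traceNorm (ketBra x - ketBra (fockState k)) =
      ENNReal.ofReal (2 * ‖x - (x : ℕ → ℂ) k • fockState k‖) := by
  have h := norm_sub_smul_fockState_sq x k
  rw [hx, one_pow] at h
  rw [traceNorm_ketBra_sub hx (norm_fockState k), norm_inner_symm, inner_fockState_left, ← h,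
    Real.sqrt_sq (norm_nonneg _)]

theorem tendsto_spectralDecomposition {m : ℝ} (hm : 0 < m) {T : ℕ → FockSpace →L[ℂ] FockSpace}
    (hT : Tendsto T atTop (𝓝 (gaussianState m))) {N : ℕ → ℕ} {lam : ℕ → ℕ → ℝ}
    {φ : ℕ → ℕ → FockSpace} (hφ : ∀ n, IsSpectralDecomposition (T n) (N n) (lam n) (φ n))
    (h0 : ∀ n, ∀ i < N n, 0 ≤ lam n i) (k : ℕ) :
    (∀ᶠ n in atTop, k < N n) ∧
      Tendsto (fun n => lam n k) atTop (𝓝 (thermalEigenvalue m k)) ∧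
      Tendsto (fun n => ‖φ n k - (φ n k : ℕ → ℂ) k • fockState k‖) atTop (𝓝 0) := by
  induction k using Nat.strong_induction_on with
  | _ k ih =>
  have hrest : Tendsto (fun n => ‖T n - ∑ i ∈ Finset.range k, lam n i • ketBra (φ n i)‖) atTop
      (𝓝 (thermalEigenvalue m k)) := by
    rw [← norm_gaussianState_sub_sum hm k]
    refine (hT.sub (tendsto_finsetSum _ fun i hi => ?_)).norm
    obtain ⟨hi1, hi2, hi3⟩ := ih i (Finset.mem_range.1 hi)
    refine hi2.smul (tendsto_iff_norm_sub_tendsto_zero.2 ?_)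
    have h3 := hi3.const_mul 3
    rw [mul_zero] at h3
    refine squeeze_zero' (Eventually.of_forall fun _ => norm_nonneg _) ?_ h3
    filter_upwards [hi1] with n hn
    exact norm_ketBra_sub_ketBra_fockState_le ((hφ n).norm_eq_one hn) i
  have hN : ∀ᶠ n in atTop, k ≤ N n := by
    rcases k with _ | k
    · exact Eventually.of_forall fun _ => Nat.zero_le _
    · exact (ih k (Nat.lt_succ_self k)).1
  have hN' : ∀ᶠ n in atTop, k < N n := by
    filter_upwards [hN, hrest.eventually_const_lt (thermalEigenvalue_pos hm k)] with n h1 h2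
    -- If N n = k, the remainder is zero, contradicting its positive limiting norm.
    refine lt_of_le_of_ne h1 fun h => ?_
    have h3 := (hφ n).eq_sum
    rw [← h] at h3
    rw [h3, sub_self, norm_zero] at h2
    exact lt_irrefl _ h2
  have hlam : Tendsto (fun n => lam n k) atTop (𝓝 (thermalEigenvalue m k)) := by
    refine hrest.congr' ?_
    filter_upwards [hN'] with n hn
    exact (hφ n).norm_sub_sum_eq (h0 n) hn
  refine ⟨hN', hlam, ?_⟩
  obtain ⟨g, hg0, hg⟩ := exists_spectralGap hm k
  have hlim : Tendsto (fun n => g⁻¹ * (‖T n - gaussianState m‖ +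
      ‖lam n k - thermalEigenvalue m k‖)) atTop (𝓝 0) := by
    simpa using ((tendsto_iff_norm_sub_tendsto_zero.1 hT).add
      (tendsto_iff_norm_sub_tendsto_zero.1 hlam)).const_mul g⁻¹
  refine squeeze_zero' (Eventually.of_forall fun _ => norm_nonneg _) ?_ hlim
  filter_upwards [hN'] with n hn
  rw [le_inv_mul_iff₀ hg0]
  refine (mul_norm_sub_smul_fockState_le hm hg0.le hg (φ n k)).trans ?_
  -- The eigenvalue equation for `T n` bounds the defect of φ n k as an eigenvector of the limit by
  -- the operator error plus the eigenvalue error.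
  have h1 : gaussianState m (φ n k) - (thermalEigenvalue m k : ℂ) • φ n k =
      ((lam n k - thermalEigenvalue m k : ℝ) : ℂ) • φ n k - (T n - gaussianState m) (φ n k) := by
    rw [sub_apply, (hφ n).apply_eigenvector hn, Complex.ofReal_sub, sub_smul]
    abel
  have h2 := (T n - gaussianState m).le_opNorm (φ n k)
  rw [(hφ n).norm_eq_one hn, mul_one] at h2
  rw [h1, add_comm]
  refine (norm_sub_le _ _).trans (add_le_add (le_of_eq ?_) h2)
  rw [norm_smul, (hφ n).norm_eq_one hn, mul_one, Complex.norm_real]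

theorem proposition2 (m : ℝ) (hm : 0 < m) (X : ℕ → Constellation)
    (hX : WeaklyConverges (fun n => (X n).state) (gaussianState m))
    (N : ℕ → ℕ) (lam : ℕ → ℕ → ℝ) (φ : ℕ → ℕ → FockSpace)
    (hφ : ∀ n, IsSpectralDecomposition (X n).state (N n) (lam n) (φ n)) :
    HasSum (fun k => thermalEigenvalue m k • ketBra (fockState k)) (gaussianState m) ∧
    ∀ k : ℕ,
      (∀ᶠ n in atTop, k < N n) ∧
      Tendsto (fun n => |lam n k - thermalEigenvalue m k|) atTop (𝓝 0) ∧
      Tendsto (fun n => traceNorm (ketBra (φ n k) - ketBra (fockState k))) atTop (𝓝 0) := by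
  refine ⟨hasSum_thermalEigenvalue_smul_ketBra hm, fun k => ?_⟩
  obtain ⟨h1, h2, h3⟩ := tendsto_spectralDecomposition hm (tendsto_constellationState hm hX) hφ
    (fun n i hi => (hφ n).nonneg_of_state hi) k
  refine ⟨h1, tendsto_iff_norm_sub_tendsto_zero.1 h2, ?_⟩
  have h4 := ENNReal.tendsto_ofReal (h3.const_mul 2)
  rw [mul_zero, ENNReal.ofReal_zero] at h4
  refine h4.congr' ?_
  filter_upwards [h1] with n hn
  exact (traceNorm_ketBra_sub_ketBra_fockState ((hφ n).norm_eq_one hn) k).symm
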